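/- For a permutation $\sigma$ of $[n]=\{1,\dots,n\}$, a crossing of $\sigma$ is a pair $(i,j)\in[n]^2$ such that $i<j<\sigma(i)<\sigma(j)$ or $\sigma(i)<\sigma(j)\le i<j$; let $\mathrm{crs}(\sigma)$ be the number of crossings of $\sigma$. For a permutation $\tau$ of $[m]$, let $S_n(\tau)$ be the set of permutations $\sigma$ of $[n]$ that avoid $\tau$, that is, for which there are no indices $i_1<\dots<i_m$ such that $\sigma(i_1)\cdots\sigma(i_m)$ is in the same relative order as $\tau(1)\cdots\tau(m)$. Then for every integer $n\ge 1$, as polynomials in $q$, $$\sum_{\sigma\in S_n(321)}q^{\mathrm{crs}(\sigma)}=\sum_{\sigma\in S_n(132)}q^{\mathrm{crs}(\sigma)}=\sum_{\sigma\in S_n(213)}q^{\mathrm{crs}(\sigma)}.$$ -/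

import Mathlib

/-! Permutations of `{1, …, n}` are modelled as `Equiv.Perm (Fin n)`: the element `k` of
`{1, …, n}` is the element `k - 1` of `Fin n`. All notions below only compare positions and
values, so they do not depend on this shift. -/

namespace PermCrossing

/-- `σ` contains the pattern `τ`: there are positions `i 0 < i 1 < ⋯ < i (m - 1)` such that
the word `σ (i 0) ⋯ σ (i (m - 1))` is in the same relative order as `τ 0 ⋯ τ (m - 1)`. -/
def Contains {n m : ℕ} (σ : Equiv.Perm (Fin n)) (τ : Equiv.Perm (Fin m)) : Prop :=
  ∃ i : Fin m → Fin n, StrictMono i ∧ ∀ a b : Fin m, σ (i a) < σ (i b) ↔ τ a < τ b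

instance {n m : ℕ} (τ : Equiv.Perm (Fin m)) :
    DecidablePred fun σ : Equiv.Perm (Fin n) => Contains σ τ := fun σ => by
  unfold Contains StrictMono
  infer_instance

/-- The set `S_n(τ)` of permutations of `n` letters that avoid the pattern `τ`. -/
def avoiders (n : ℕ) {m : ℕ} (τ : Equiv.Perm (Fin m)) : Finset (Equiv.Perm (Fin n)) :=
  Finset.univ.filter fun σ => ¬ Contains σ τ

/-- The number of crossings of `σ`: the number of pairs `(i, j)` such that
`i < j < σ i < σ j` or `σ i < σ j ≤ i < j`. -/
def crs {n : ℕ} (σ : Equiv.Perm (Fin n)) : ℕ :=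
  (Finset.univ.filter fun p : Fin n × Fin n =>
    (p.1 < p.2 ∧ p.2 < σ p.1 ∧ σ p.1 < σ p.2) ∨
    (σ p.1 < σ p.2 ∧ σ p.2 ≤ p.1 ∧ p.1 < p.2)).card

/-- The distribution polynomial `∑ q ^ crs σ` of the number of crossings over the permutations
of `n` letters that avoid `τ`. -/
noncomputable def crsPoly (n : ℕ) {m : ℕ} (τ : Equiv.Perm (Fin m)) : Polynomial ℤ :=
  ∑ σ ∈ avoiders n τ, Polynomial.X ^ crs σ

/-- The pattern `321` (one-line notation `2 1 0` with letters counted from zero). -/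
def pattern321 : Equiv.Perm (Fin 3) where
  toFun := ![2, 1, 0]
  invFun := ![2, 1, 0]
  left_inv := by decide
  right_inv := by decide

/-- The pattern `132` (one-line notation `0 2 1` with letters counted from zero). -/
def pattern132 : Equiv.Perm (Fin 3) where
  toFun := ![0, 2, 1]
  invFun := ![0, 2, 1]
  left_inv := by decide
  right_inv := by decide

/-- The pattern `213` (one-line notation `1 0 2` with letters counted from zero). -/
def pattern213 : Equiv.Perm (Fin 3) where
  toFun := ![1, 0, 2]
  invFun := ![1, 0, 2]
  left_inv := by decide
  right_inv := by decide

end PermCrossing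

/-! ### Pattern containment and the symmetry between 132 and 213 -/

namespace PermCrossing

/-! Reverse-complement-inverse exchanges 132 and 213 and keeps crossings. For 321 against 132, both
sums equal the value at 1 of `U ^ n 1`, where `U = growth q`.

Avoiding 321: crossings number the same as the total excess (`crs_eq_excess`). Inserting a new
maximum keeps 321 avoided exactly when the entries to its right increase, so the length of the
increasing suffix is the label of a generating tree whose rule is `U` (`tailPoly_succ`). In the
basis `qFall`, whose members of positive degree vanish at 1, `U` is tridiagonal
(`growth_qFall_succ`).

Avoiding 132: the maximum splits the word into two blocks, the left one above the right one.
Shifting values against positions makes the crossing count split too (`crsShift_glue`). The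
recursion is the first-return decomposition of Dyck paths on an interval of the line, the shift
being minus its midpoint. With `q = s ^ 2`, an arc joining steps `a` and `b` weighs `s ^ (||a| -
|b|| - 1)`; the original sum belongs to the interval from `-n` to `n`.

This weight factors into a part for each end once it is known which of `|a|`, `|b|` is larger. An
arc at an outermost step can then be cut, leaving its partner as an open step. Lengthening the
interval from `-r` to `r` by one step at both ends yields a three-term recursion in the number of
open steps (`openSum_succ_symm`), which after rescaling is the action of `U` on `qFall`
(`openSum_eq_eval_growth`). -/

theorem contains_three_iff {n : ℕ} (σ : Equiv.Perm (Fin n)) (τ : Equiv.Perm (Fin 3)) :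
    Contains σ τ ↔ ∃ a b c : Fin n, a < b ∧ b < c ∧
      (σ a < σ b ↔ τ 0 < τ 1) ∧ (σ a < σ c ↔ τ 0 < τ 2) ∧ (σ b < σ c ↔ τ 1 < τ 2) := by
  constructor
  · rintro ⟨i, hi, h⟩
    exact ⟨i 0, i 1, i 2, hi (by decide), hi (by decide), h 0 1, h 0 2, h 1 2⟩
  · rintro ⟨a, b, c, hab, hbc, h1, h2, h3⟩
    refine ⟨![a, b, c], ?_, ?_⟩
    · intro x y hxy
      fin_cases x <;> fin_cases y <;> simp_all
      exact hab.trans hbc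
    · have key : ∀ x y : Fin n, ∀ u v : Fin 3, x ≠ y → u ≠ v →
          (σ x < σ y ↔ τ u < τ v) → (σ y < σ x ↔ τ v < τ u) := by
        intro x y u v hxy huv h
        have e1 := σ.injective.ne hxy
        have e2 := τ.injective.ne huv
        rw [lt_iff_not_ge, lt_iff_not_ge, le_iff_lt_or_eq, le_iff_lt_or_eq, h]
        simp [e1, e2]
      have k1 := key a b 0 1 hab.ne (by decide) h1
      have k2 := key a c 0 2 (hab.trans hbc).ne (by decide) h2
      have k3 := key b c 1 2 hbc.ne (by decide) h3
      intro x y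
      fin_cases x <;> fin_cases y <;> simp [h1, h2, h3, k1, k2, k3]

theorem contains_pattern321_iff {n : ℕ} (σ : Equiv.Perm (Fin n)) :
    Contains σ pattern321 ↔ ∃ a b c : Fin n, a < b ∧ b < c ∧ σ c < σ b ∧ σ b < σ a := by
  rw [contains_three_iff]
  constructor
  · rintro ⟨a, b, c, hab, hbc, h1, h2, h3⟩
    have e1 := σ.injective.ne hab.ne
    have e3 := σ.injective.ne hbc.ne
    simp [pattern321] at h1 h2 h3
    exact ⟨a, b, c, hab, hbc, lt_of_le_of_ne h3 e3.symm, lt_of_le_of_ne h1 e1.symm⟩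
  · rintro ⟨a, b, c, hab, hbc, h1, h2⟩
    refine ⟨a, b, c, hab, hbc, ?_⟩
    simp [pattern321, h1.le, h2.le, (h1.trans h2).le]

theorem contains_pattern132_iff {n : ℕ} (σ : Equiv.Perm (Fin n)) :
    Contains σ pattern132 ↔ ∃ a b c : Fin n, a < b ∧ b < c ∧ σ a < σ c ∧ σ c < σ b := by
  rw [contains_three_iff]
  constructor
  · rintro ⟨a, b, c, hab, hbc, h1, h2, h3⟩
    have e3 := σ.injective.ne hbc.ne
    simp [pattern132] at h1 h2 h3
    exact ⟨a, b, c, hab, hbc, h2, lt_of_le_of_ne h3 e3.symm⟩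
  · rintro ⟨a, b, c, hab, hbc, h1, h2⟩
    refine ⟨a, b, c, hab, hbc, ?_⟩
    simp [pattern132, h1, h2.le, h1.trans h2]

theorem contains_pattern213_iff {n : ℕ} (σ : Equiv.Perm (Fin n)) :
    Contains σ pattern213 ↔ ∃ a b c : Fin n, a < b ∧ b < c ∧ σ b < σ a ∧ σ a < σ c := by
  rw [contains_three_iff]
  constructor
  · rintro ⟨a, b, c, hab, hbc, h1, h2, h3⟩
    have e1 := σ.injective.ne hab.ne
    simp [pattern213] at h1 h2 h3
    exact ⟨a, b, c, hab, hbc, lt_of_le_of_ne h1 e1.symm, h2⟩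
  · rintro ⟨a, b, c, hab, hbc, h1, h2⟩
    refine ⟨a, b, c, hab, hbc, ?_⟩
    simp [pattern213, h2, h1.le, h1.trans h2]

theorem mem_avoiders {n m : ℕ} {τ : Equiv.Perm (Fin m)} {σ : Equiv.Perm (Fin n)} :
    σ ∈ avoiders n τ ↔ ¬ Contains σ τ := by
  simp [avoiders]

/-- The reverse-complement-inverse of a permutation. -/
def revCompInv {n : ℕ} (σ : Equiv.Perm (Fin n)) : Equiv.Perm (Fin n) :=
  Fin.revPerm.trans (σ.symm.trans Fin.revPerm)

theorem revCompInv_apply {n : ℕ} (σ : Equiv.Perm (Fin n)) (i : Fin n) :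
    revCompInv σ i = (σ.symm i.rev).rev := rfl

theorem revCompInv_revCompInv {n : ℕ} (σ : Equiv.Perm (Fin n)) :
    revCompInv (revCompInv σ) = σ := by
  ext i
  simp [revCompInv]

theorem contains_revCompInv {n : ℕ} (σ : Equiv.Perm (Fin n)) :
    Contains (revCompInv σ) pattern213 ↔ Contains σ pattern132 := by
  rw [contains_pattern132_iff, contains_pattern213_iff]
  constructor
  · rintro ⟨a, b, c, hab, hbc, h1, h2⟩
    simp only [revCompInv_apply, Fin.rev_lt_rev] at h1 h2
    exact ⟨_, _, _, h2, h1, by simpa using hbc, by simpa using hab⟩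
  · rintro ⟨a, b, c, hab, hbc, h1, h2⟩
    refine ⟨(σ b).rev, (σ c).rev, (σ a).rev, ?_⟩
    simp [revCompInv_apply, *]

/-- The point `(i, σ i)` of the graph moves to `((σ i).rev, i.rev)`. This reverses the order within
a pair and preserves each of the two kinds of crossing. -/
theorem crs_revCompInv {n : ℕ} (σ : Equiv.Perm (Fin n)) : crs (revCompInv σ) = crs σ := by
  symm
  refine Finset.card_bij' (fun p _ => ((σ p.2).rev, (σ p.1).rev))
    (fun p _ => (σ.symm p.2.rev, σ.symm p.1.rev)) ?_ ?_ ?_ ?_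
  · rintro ⟨i, j⟩ h
    simp only [Finset.mem_filter, Finset.mem_univ, true_and, revCompInv_apply, Fin.rev_rev,
      Fin.rev_lt_rev, Fin.rev_le_rev, Equiv.symm_apply_apply] at h ⊢
    tauto
  · rintro ⟨i, j⟩ h
    simp only [Finset.mem_filter, Finset.mem_univ, true_and, revCompInv_apply, Fin.lt_def,
      Fin.le_def, Fin.val_rev, Equiv.apply_symm_apply] at h ⊢
    omega
  · rintro ⟨i, j⟩ h
    simp
  · rintro ⟨i, j⟩ h
    simp

theorem crsPoly_pattern132_eq_pattern213 (n : ℕ) :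
    crsPoly n pattern132 = crsPoly n pattern213 := by
  refine Finset.sum_bij' (fun σ _ => revCompInv σ) (fun σ _ => revCompInv σ) ?_ ?_ ?_ ?_ ?_
  · intro σ h
    rw [mem_avoiders] at h ⊢
    rwa [contains_revCompInv]
  · intro σ h
    rw [mem_avoiders] at h ⊢
    rwa [← contains_revCompInv, revCompInv_revCompInv]
  · intro σ _
    exact revCompInv_revCompInv σ
  · intro σ _
    exact revCompInv_revCompInv σ
  · intro σ _
    rw [crs_revCompInv]

end PermCrossing

/-! ### Crossings of 321-avoiding permutations as total excess -/

namespace PermCrossing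

/-- The total excess `∑ (σ i - i - 1)` over the excedances `i` of `σ`. -/
def excess {n : ℕ} (σ : Equiv.Perm (Fin n)) : ℕ :=
  ∑ i : Fin n, ((σ i : ℕ) - i - 1)

/-- Positions `≤ j` and positions of values `≤ j` are equinumerous; removing the common part leaves
these two sets. -/
theorem card_filter_lt_apply {n : ℕ} (σ : Equiv.Perm (Fin n)) (j : Fin n) :
    (Finset.univ.filter fun i => i ≤ j ∧ j < σ i).card =
      (Finset.univ.filter fun i => j < i ∧ σ i ≤ j).card := by
  have h1 := Finset.card_filter_add_card_filter_not (s := Finset.Iic j) (fun i => j < σ i)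
  have h2 := Finset.card_filter_add_card_filter_not (s := Finset.univ.filter fun i => σ i ≤ j)
    (fun i => j < i)
  have h3 : (Finset.univ.filter fun i => σ i ≤ j).card = (Finset.Iic j).card :=
    Finset.card_bij' (fun i _ => σ i) (fun i _ => σ.symm i) (by simp) (by simp) (by simp) (by simp)
  have e1 : (Finset.univ.filter fun i => i ≤ j ∧ j < σ i) =
      (Finset.Iic j).filter fun i => j < σ i := by ext; simp
  have e2 : (Finset.univ.filter fun i => j < i ∧ σ i ≤ j) =
      (Finset.univ.filter fun i => σ i ≤ j).filter fun i => j < i := by ext; simp [and_comm]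
  have e3 : ((Finset.univ.filter fun i => σ i ≤ j).filter fun i => ¬ j < i) =
      (Finset.Iic j).filter fun i => ¬ j < σ i := by ext; simp [and_comm]
  rw [e1, e2]
  rw [e3] at h2
  omega

/-- In a permutation avoiding `321`, an entry with a larger entry to its left is a strict
anti-excedance. -/
theorem apply_lt_of_avoids_pattern321 {n : ℕ} {σ : Equiv.Perm (Fin n)}
    (h : ¬ Contains σ pattern321) {i j : Fin n} (hij : i < j) (hσ : σ j < σ i) : σ j < j := by
  rw [contains_pattern321_iff] at h
  push Not at h
  -- Values `≤ σ j` sit at positions `≤ j`, since one further right would complete a 321 with `i`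
  -- and `j`; none sits at `i`. Hence `σ j + 1 ≤ j`.
  have hsub : (Finset.Iic (σ j)).map σ.symm.toEmbedding ⊆ (Finset.Iic j).erase i := by
    intro k hk
    simp only [Finset.mem_map_equiv, Equiv.symm_symm, Finset.mem_Iic] at hk
    simp only [Finset.mem_erase, Finset.mem_Iic]
    refine ⟨?_, ?_⟩
    · rintro rfl
      exact absurd hσ (not_lt.2 hk)
    · by_contra! hjk
      have := h i j k hij hjk (lt_of_le_of_ne hk (σ.injective.ne hjk.ne'))
      exact absurd hσ (not_lt.2 this)
  have := Finset.card_le_card hsub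
  rw [Finset.card_map, Finset.card_erase_of_mem (by simpa using hij.le), Fin.card_Iic,
    Fin.card_Iic] at this
  rw [Fin.lt_def]
  omega

/-- Every strict anti-excedance of a permutation has a larger entry to its left. -/
theorem exists_lt_of_apply_lt {n : ℕ} (σ : Equiv.Perm (Fin n)) {j : Fin n} (h : σ j < j) :
    ∃ i < j, σ j < σ i := by
  by_contra! hc
  have hsub : (Finset.Iic j).map σ.toEmbedding ⊆ Finset.Iic (σ j) := by
    intro k hk
    simp only [Finset.mem_map, Finset.mem_Iic, Equiv.coe_toEmbedding] at hk
    obtain ⟨i, hi, rfl⟩ := hk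
    rcases hi.lt_or_eq with hi | rfl
    · simpa using hc i hi
    · simp
  have := Finset.card_le_card hsub
  rw [Finset.card_map, Fin.card_Iic, Fin.card_Iic] at this
  rw [Fin.lt_def] at h
  omega

/-- The excess counts pairs `i < j < σ i`. Those with `σ i < σ j` are the upper crossings. For fixed
`j`, the others match the lower crossings with first index `j`: both are absent unless `σ j < j`,
and then they count the entries passing the cut after `j` upwards and downwards. -/
theorem crs_eq_excess {n : ℕ} {σ : Equiv.Perm (Fin n)} (h : ¬ Contains σ pattern321) :
    crs σ = excess σ := by
  have h' := h
  rw [contains_pattern321_iff] at h'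
  push Not at h'
  have hex : excess σ = (Finset.univ.filter fun p : Fin n × Fin n =>
      p.1 < p.2 ∧ p.2 < σ p.1).card := by
    rw [Finset.card_filter, Fintype.sum_prod_type]
    refine Finset.sum_congr rfl fun i _ => ?_
    rw [← Finset.card_filter]
    have : (Finset.univ.filter fun j => i < j ∧ j < σ i) = Finset.Ioo i (σ i) := by
      ext; simp
    rw [this, Fin.card_Ioo]
  have hlow : (Finset.univ.filter fun p : Fin n × Fin n =>
      (p.1 < p.2 ∧ p.2 < σ p.1) ∧ σ p.2 < σ p.1).card =
      (Finset.univ.filter fun p : Fin n × Fin n =>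
        σ p.1 < σ p.2 ∧ σ p.2 ≤ p.1 ∧ p.1 < p.2).card := by
    rw [Finset.card_filter, Finset.card_filter, Fintype.sum_prod_type_right,
      Fintype.sum_prod_type]
    refine Finset.sum_congr rfl fun j _ => ?_
    rw [← Finset.card_filter, ← Finset.card_filter]
    by_cases hj : σ j < j
    · have e1 : (Finset.univ.filter fun i => (i < j ∧ j < σ i) ∧ σ j < σ i) =
          Finset.univ.filter fun i => i ≤ j ∧ j < σ i := by
        ext i
        simp only [Finset.mem_filter, Finset.mem_univ, true_and]
        constructor
        · rintro ⟨⟨h1, h2⟩, h3⟩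
          exact ⟨h1.le, h2⟩
        · rintro ⟨h1, h2⟩
          refine ⟨⟨lt_of_le_of_ne h1 ?_, h2⟩, hj.trans h2⟩
          rintro rfl
          exact absurd hj (not_lt.2 h2.le)
      rw [e1, card_filter_lt_apply]
      congr 1
      ext i
      simp only [Finset.mem_filter, Finset.mem_univ, true_and]
      constructor
      · rintro ⟨h1, h2⟩
        refine ⟨?_, h2, h1⟩
        obtain ⟨k, hk, hk'⟩ := exists_lt_of_apply_lt σ hj
        by_contra! hc
        exact absurd hk' (not_lt.2 (h' k j i hk h1 (lt_of_le_of_ne hc (σ.injective.ne h1.ne'))))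
      · rintro ⟨h1, h2, h3⟩
        exact ⟨h3, h2⟩
    · rw [Finset.filter_false_of_mem, Finset.filter_false_of_mem]
      · rintro i - ⟨h1, h2, h3⟩
        exact hj (h1.trans_le h2)
      · rintro i - ⟨⟨h1, h2⟩, h3⟩
        exact hj (apply_lt_of_avoids_pattern321 h h1 h3)
  have hsplit := Finset.card_filter_add_card_filter_not
    (s := Finset.univ.filter fun p : Fin n × Fin n => p.1 < p.2 ∧ p.2 < σ p.1)
    (fun p => σ p.2 < σ p.1)
  rw [Finset.filter_filter, Finset.filter_filter, hlow] at hsplit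
  rw [hex, ← hsplit, crs, Finset.filter_or, Finset.card_union_of_disjoint, add_comm]
  · congr 2
    ext ⟨i, j⟩
    simp only [Finset.mem_filter, Finset.mem_univ, true_and, not_lt]
    constructor
    · rintro ⟨h1, h2, h3⟩
      exact ⟨⟨h1, h2⟩, h3.le⟩
    · rintro ⟨⟨h1, h2⟩, h3⟩
      exact ⟨h1, h2, lt_of_le_of_ne h3 (σ.injective.ne h1.ne)⟩
  · rw [Finset.disjoint_filter]
    rintro ⟨i, j⟩ - ⟨h1, h2, h3⟩ ⟨h4, h5, h6⟩
    exact absurd (h2.trans h3) (not_lt.2 (h5.trans h1.le))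

end PermCrossing

/-! ### Inserting a maximum into a 321-avoiding permutation -/

namespace PermCrossing

/-- Insertion of a new largest entry at position `p`. -/
def insertMax {n : ℕ} (p : Fin (n + 1)) (σ : Equiv.Perm (Fin n)) : Equiv.Perm (Fin (n + 1)) :=
  (finSuccEquiv' p).trans ((Equiv.optionCongr σ).trans (finSuccEquiv' (Fin.last n)).symm)

@[simp]
theorem insertMax_self {n : ℕ} (p : Fin (n + 1)) (σ : Equiv.Perm (Fin n)) :
    insertMax p σ p = Fin.last n := by
  simp [insertMax]

@[simp]
theorem insertMax_succAbove {n : ℕ} (p : Fin (n + 1)) (σ : Equiv.Perm (Fin n)) (i : Fin n) :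
    insertMax p σ (p.succAbove i) = (σ i).castSucc := by
  simp [insertMax]

theorem insertMax_bijective (n : ℕ) : Function.Bijective
    (fun x : Fin (n + 1) × Equiv.Perm (Fin n) => insertMax x.1 x.2) := by
  rw [Fintype.bijective_iff_injective_and_card]
  constructor
  · rintro ⟨p, σ⟩ ⟨p', σ'⟩ h
    simp only at h
    have hp : p = p' := by
      apply (insertMax p σ).injective
      rw [insertMax_self, h, insertMax_self]
    subst hp
    congr 1
    ext i
    have := congrArg (fun τ => τ (p.succAbove i)) h
    simp only [insertMax_succAbove, Fin.castSucc_inj] at this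
    rw [this]
  · simp [Fintype.card_perm, Nat.factorial_succ]

/-- The entries of `σ` at positions `≥ p` are increasing. -/
def IncTail {n : ℕ} (σ : Equiv.Perm (Fin n)) (p : ℕ) : Prop :=
  ∀ i j : Fin n, p ≤ i → i < j → σ i < σ j

open Classical in
/-- The length of the longest increasing suffix of `σ`. -/
noncomputable def tailLength {n : ℕ} (σ : Equiv.Perm (Fin n)) : ℕ :=
  (Finset.univ.filter fun i : Fin n => IncTail σ i).card

theorem IncTail.mono {n : ℕ} {σ : Equiv.Perm (Fin n)} {p r : ℕ} (h : IncTail σ p) (hpr : p ≤ r) :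
    IncTail σ r :=
  fun i j hi hij => h i j (hpr.trans hi) hij

theorem tailLength_le {n : ℕ} (σ : Equiv.Perm (Fin n)) : tailLength σ ≤ n :=
  (Finset.card_le_univ _).trans_eq (Fintype.card_fin n)

/-- The positions satisfying `IncTail σ` form a final segment, so their number determines them. At
`p = n` the condition is vacuous. -/
theorem incTail_iff {n : ℕ} (σ : Equiv.Perm (Fin n)) {p : ℕ} (hp : p ≤ n) :
    IncTail σ p ↔ n ≤ p + tailLength σ := by
  classical
  rcases hp.eq_or_lt with rfl | hp
  · simp only [le_add_iff_nonneg_right, zero_le, iff_true]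
    intro i j hi
    omega
  constructor
  · intro h
    have hsub : Finset.Ici (⟨p, hp⟩ : Fin n) ⊆ Finset.univ.filter fun i : Fin n => IncTail σ i := by
      intro i hi
      simp only [Finset.mem_Ici, Finset.mem_filter, Finset.mem_univ, true_and] at hi ⊢
      exact h.mono hi
    have := Finset.card_le_card hsub
    rw [Fin.card_Ici] at this
    unfold tailLength
    simp only at this
    omega
  · intro h
    by_contra hc
    have hsub : (Finset.univ.filter fun i : Fin n => IncTail σ i) ⊆
        Finset.Ioi (⟨p, hp⟩ : Fin n) := by
      intro i hi
      simp only [Finset.mem_Ioi, Finset.mem_filter, Finset.mem_univ, true_and] at hi ⊢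
      by_contra! hle
      exact hc (hi.mono hle)
    have := Finset.card_le_card hsub
    rw [Fin.card_Ioi] at this
    unfold tailLength at h
    simp only at this
    omega

theorem tailLength_eq_of_forall {n : ℕ} (σ : Equiv.Perm (Fin n)) {t : ℕ} (ht : t ≤ n)
    (h : ∀ p ≤ n, IncTail σ p ↔ n ≤ p + t) : tailLength σ = t := by
  have h1 := (h (n - tailLength σ) (Nat.sub_le _ _)).1
    ((incTail_iff σ (Nat.sub_le _ _)).2 (by omega))
  have h2 := (incTail_iff σ (Nat.sub_le n t)).1 ((h (n - t) (Nat.sub_le _ _)).2 (by omega))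
  have := tailLength_le σ
  omega

theorem val_succAbove_of_lt {n : ℕ} (p : Fin (n + 1)) (i : Fin n) (h : (i : ℕ) < p) :
    (p.succAbove i : ℕ) = i := by
  rw [Fin.succAbove_of_castSucc_lt _ _ h, Fin.val_castSucc]

theorem val_succAbove_of_le {n : ℕ} (p : Fin (n + 1)) (i : Fin n) (h : (p : ℕ) ≤ i) :
    (p.succAbove i : ℕ) = i + 1 := by
  rw [Fin.succAbove_of_le_castSucc _ _ h, Fin.val_succ]

/-- The new maximum can only play the 3 of a 321, with a descending pair to its right. -/
theorem not_contains_insertMax_iff {n : ℕ} (p : Fin (n + 1)) (σ : Equiv.Perm (Fin n)) :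
    ¬ Contains (insertMax p σ) pattern321 ↔ ¬ Contains σ pattern321 ∧ IncTail σ p := by
  rw [← not_iff_not, not_not, not_and_or, not_not, contains_pattern321_iff,
    contains_pattern321_iff]
  constructor
  · rintro ⟨a, b, c, hab, hbc, h1, h2⟩
    rcases Fin.eq_self_or_eq_succAbove p b with rfl | ⟨b, rfl⟩
    · rw [insertMax_self] at h2
      exact absurd h2 (not_lt.2 (Fin.le_last _))
    rcases Fin.eq_self_or_eq_succAbove p c with rfl | ⟨c, rfl⟩
    · rw [insertMax_self] at h1
      exact absurd h1 (not_lt.2 (Fin.le_last _))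
    rw [Fin.succAbove_lt_succAbove_iff] at hbc
    rw [insertMax_succAbove, insertMax_succAbove, Fin.castSucc_lt_castSucc_iff] at h1
    rcases Fin.eq_self_or_eq_succAbove p a with rfl | ⟨a, rfl⟩
    · right
      intro h
      rw [Fin.lt_succAbove_iff_le_castSucc] at hab
      exact absurd h1 (not_lt.2 (h b c hab hbc).le)
    · left
      rw [Fin.succAbove_lt_succAbove_iff] at hab
      rw [insertMax_succAbove, insertMax_succAbove, Fin.castSucc_lt_castSucc_iff] at h2
      exact ⟨a, b, c, hab, hbc, h1, h2⟩
  · rintro (⟨a, b, c, hab, hbc, h1, h2⟩ | h)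
    · exact ⟨p.succAbove a, p.succAbove b, p.succAbove c, by simp [*]⟩
    · unfold IncTail at h
      push Not at h
      obtain ⟨b, c, hpb, hbc, h1⟩ := h
      have h1' := lt_of_le_of_ne h1 (σ.injective.ne hbc.ne')
      refine ⟨p, p.succAbove b, p.succAbove c, ?_, by simpa using hbc, by simpa using h1', ?_⟩
      · rw [Fin.lt_succAbove_iff_le_castSucc]
        exact hpb
      · rw [insertMax_self, insertMax_succAbove]
        exact Fin.castSucc_lt_last _

/-- Entries right of the new maximum are strict anti-excedances, so their truncated contribution is
0 both before and after moving one place. At `p = n` the new entry's term truncates to 0. -/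
theorem excess_insertMax {n : ℕ} (p : Fin (n + 1)) {σ : Equiv.Perm (Fin n)}
    (h : ¬ Contains (insertMax p σ) pattern321) :
    excess (insertMax p σ) = n - p - 1 + excess σ := by
  unfold excess
  rw [Fin.sum_univ_succAbove _ p, insertMax_self, Fin.val_last]
  congr 1
  refine Finset.sum_congr rfl fun i _ => ?_
  rw [insertMax_succAbove, Fin.val_castSucc]
  rcases lt_or_ge (i : ℕ) p with hi | hi
  · rw [val_succAbove_of_lt p i hi]
  · have h1 : p < p.succAbove i := by
      rw [Fin.lt_succAbove_iff_le_castSucc]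
      exact hi
    have h2 := apply_lt_of_avoids_pattern321 h h1
      (by rw [insertMax_self, insertMax_succAbove]; exact Fin.castSucc_lt_last _)
    rw [insertMax_succAbove, Fin.lt_def, Fin.val_castSucc] at h2
    rw [val_succAbove_of_le p i hi] at h2 ⊢
    omega

theorem tailLength_insertMax_last {n : ℕ} (σ : Equiv.Perm (Fin n)) :
    tailLength (insertMax (Fin.last n) σ) = tailLength σ + 1 := by
  apply tailLength_eq_of_forall _ (by simpa using tailLength_le σ)
  intro p hp
  rcases hp.eq_or_lt with rfl | hp
  · exact ⟨fun _ => by omega, fun _ i j hi _ => by omega⟩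
  have key : IncTail (insertMax (Fin.last n) σ) p ↔ IncTail σ p := by
    constructor
    · intro h i j hi hij
      have := h ((Fin.last n).succAbove i) ((Fin.last n).succAbove j)
        (by simpa using hi) (by simpa using hij)
      simpa only [insertMax_succAbove, Fin.castSucc_lt_castSucc_iff] using this
    · intro h i j hi hij
      rcases Fin.eq_self_or_eq_succAbove (Fin.last n) i with rfl | ⟨i, rfl⟩
      · exact absurd hij (not_lt.2 (Fin.le_last _))
      rcases Fin.eq_self_or_eq_succAbove (Fin.last n) j with rfl | ⟨j, rfl⟩
      · rw [insertMax_self, insertMax_succAbove]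
        exact Fin.castSucc_lt_last _
      · rw [insertMax_succAbove, insertMax_succAbove, Fin.castSucc_lt_castSucc_iff]
        exact h i j (by simpa using hi) (by simpa using hij)
  rw [key, incTail_iff σ (by omega)]
  omega

theorem tailLength_insertMax_of_lt {n : ℕ} {p : Fin (n + 1)} (hp : (p : ℕ) < n)
    {σ : Equiv.Perm (Fin n)} (h : IncTail σ p) : tailLength (insertMax p σ) = n - p := by
  apply tailLength_eq_of_forall _ (by omega)
  intro r hr
  constructor
  · intro hi
    by_contra! hc
    have := hi p (p.succAbove ⟨p, hp⟩) (by omega)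
      (by rw [Fin.lt_succAbove_iff_le_castSucc]; exact le_rfl)
    rw [insertMax_self] at this
    exact absurd this (not_lt.2 (Fin.le_last _))
  · intro hpr i j hi hij
    rw [Fin.lt_def] at hij
    rcases Fin.eq_self_or_eq_succAbove p i with rfl | ⟨i, rfl⟩
    · omega
    rcases Fin.eq_self_or_eq_succAbove p j with rfl | ⟨j, rfl⟩
    · omega
    rw [← Fin.lt_def, Fin.succAbove_lt_succAbove_iff] at hij
    rw [insertMax_succAbove, insertMax_succAbove, Fin.castSucc_lt_castSucc_iff]
    refine h i j ?_ hij
    by_contra! hc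
    rw [val_succAbove_of_lt p i hc] at hi
    omega

/-! ### The growth operator and its tridiagonal form -/

open Polynomial

variable {K : Type*} [Field K]

/-- The operator on polynomials with
`X ^ a ↦ X ^ (a + 1) + ∑ r < a, q ^ r X ^ (r + 1)`, which describes the insertion of a new
largest entry in a permutation avoiding `321`. -/
noncomputable def growth (q : K) : K[X] →ₗ[K] K[X] :=
  Polynomial.lsum fun a => (LinearMap.toSpanSingleton K K[X]
    (X ^ (a + 1) + ∑ r ∈ Finset.range a, C (q ^ r) * X ^ (r + 1)))

theorem growth_X_pow (q : K) (a : ℕ) :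
    growth q (X ^ a) = X ^ (a + 1) + ∑ r ∈ Finset.range a, C (q ^ r) * X ^ (r + 1) := by
  simp [growth, ← monomial_one_right_eq_X_pow, lsum_apply]

theorem growth_C_mul (q c : K) (f : K[X]) : growth q (C c * f) = C c * growth q f := by
  rw [← smul_eq_C_mul, map_smul, smul_eq_C_mul]

/-- The joint distribution of crossings and of the length of the longest increasing suffix over
the permutations avoiding `321`. -/
noncomputable def tailPoly (q : K) (n : ℕ) : K[X] :=
  ∑ σ ∈ avoiders n pattern321, C (q ^ excess σ) * X ^ tailLength σ

/-- A permutation with suffix length `a` has one child from `p = n`, with length `a + 1` and the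
same excess, and one from each `p = n - (r + 1)` with `r < a`, with length `r + 1` and excess
increased by `r`. -/
theorem tailPoly_succ (q : K) (n : ℕ) : tailPoly q (n + 1) = growth q (tailPoly q n) := by
  classical
  unfold tailPoly avoiders
  rw [map_sum, Finset.sum_filter, ← (insertMax_bijective n).sum_comp, Fintype.sum_prod_type_right,
    Finset.sum_filter]
  refine Finset.sum_congr rfl fun σ _ => ?_
  by_cases hσ : ¬ Contains σ pattern321
  · rw [if_pos hσ]
    simp only [not_contains_insertMax_iff, hσ, true_and, not_false_eq_true]
    rw [growth_C_mul, growth_X_pow, Fin.sum_univ_castSucc]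
    have hlast : IncTail σ (Fin.last n : Fin (n + 1)) := by
      rw [incTail_iff σ (by simp)]
      simp
    rw [if_pos hlast, tailLength_insertMax_last, excess_insertMax _
      ((not_contains_insertMax_iff _ _).2 ⟨hσ, hlast⟩), mul_add, add_comm]
    congr 1
    · simp
    · rw [← Equiv.sum_comp Fin.revPerm, Finset.mul_sum]
      have : ∀ i : Fin n, (if IncTail σ (((Fin.revPerm i).castSucc : Fin (n + 1)) : ℕ) then
          C (q ^ excess (insertMax (Fin.revPerm i).castSucc σ)) *
            X ^ tailLength (insertMax (Fin.revPerm i).castSucc σ) else 0) =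
          (fun r => if r < tailLength σ then
            C (q ^ excess σ) * (C (q ^ r) * X ^ (r + 1)) else (0 : K[X])) i := by
        intro i
        have hi := i.isLt
        have hv : (((Fin.revPerm i).castSucc : Fin (n + 1)) : ℕ) = n - (i + 1) := by simp
        have hiff : IncTail σ (((Fin.revPerm i).castSucc : Fin (n + 1)) : ℕ) ↔
            (i : ℕ) < tailLength σ := by
          rw [incTail_iff σ (by omega), hv]
          omega
        by_cases h : (i : ℕ) < tailLength σ
        · simp only [if_pos h]
          have hI := hiff.2 h
          rw [if_pos hI, tailLength_insertMax_of_lt (by omega) hI, excess_insertMax _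
            ((not_contains_insertMax_iff _ _).2 ⟨hσ, hI⟩), hv,
            show n - (n - ((i : ℕ) + 1)) = i + 1 by omega, Nat.add_sub_cancel, pow_add, C_mul]
          ring
        · simp only [if_neg h]
          rw [if_neg (fun hI => h (hiff.1 hI))]
      rw [Finset.sum_congr rfl fun i _ => this i, Fin.sum_univ_eq_sum_range (fun r =>
        if r < tailLength σ then C (q ^ excess σ) * (C (q ^ r) * X ^ (r + 1)) else (0 : K[X])) n,
        ← Finset.sum_filter]
      congr 1
      ext r
      have := tailLength_le σ
      simp
      omega
  · rw [if_neg hσ]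
    refine (Finset.sum_eq_zero fun p _ => if_neg fun h => ?_).trans (map_zero (growth q)).symm
    exact hσ ((not_contains_insertMax_iff _ _).1 h).1

theorem tailPoly_zero (q : K) : tailPoly q 0 = 1 := by
  have hav : avoiders 0 pattern321 = Finset.univ := by
    ext σ
    simp only [mem_avoiders, contains_pattern321_iff, Finset.mem_univ, iff_true]
    rintro ⟨a, -⟩
    exact a.elim0
  rw [tailPoly, hav]
  simp [excess, tailLength]

theorem tailPoly_eq (q : K) (n : ℕ) : tailPoly q n = (growth q ^ n) 1 := by
  induction n with
  | zero => simp [tailPoly_zero]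
  | succ n ih => rw [tailPoly_succ, ih, pow_succ', Module.End.mul_apply]

theorem sum_crs_avoiders_pattern321 (q : K) (n : ℕ) :
    ∑ σ ∈ avoiders n pattern321, q ^ crs σ = ((growth q ^ n) 1).eval 1 := by
  rw [← tailPoly_eq, tailPoly, eval_finsetSum]
  refine Finset.sum_congr rfl fun σ hσ => ?_
  rw [crs_eq_excess (mem_avoiders.1 hσ)]
  simp

/-- The polynomials `(X - 1) (X - q) ⋯ (X - q ^ (h - 1))`. -/
noncomputable def qFall (q : K) (h : ℕ) : K[X] :=
  ∏ j ∈ Finset.range h, (X - C (q ^ j))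

theorem qFall_zero (q : K) : qFall q 0 = 1 := by simp [qFall]

theorem qFall_succ (q : K) (h : ℕ) : qFall q (h + 1) = qFall q h * (X - C (q ^ h)) :=
  Finset.prod_range_succ _ _

theorem eval_one_qFall_succ (q : K) (h : ℕ) : (qFall q (h + 1)).eval 1 = 0 := by
  rw [qFall, eval_prod]
  exact Finset.prod_eq_zero (i := 0) (by simp) (by simp)

/-- Substituting `q X` turns each factor `X - q ^ (j + 1)` into `q (X - q ^ j)`; only the factor `X
- 1` finds no partner. -/
theorem qFall_comp (q : K) (h : ℕ) :
    (qFall q (h + 1)).comp (C q * X) = (C q * X - 1) * C (q ^ h) * qFall q h := by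
  induction h with
  | zero => simp [qFall]
  | succ h ih =>
    rw [qFall_succ, mul_comp, ih, qFall_succ]
    simp only [sub_comp, X_comp, C_comp]
    simp only [pow_succ, C_mul]
    ring

/-- Summing the geometric series gives `growth f = X f + X (f(qX) - f(1)) / (qX - 1)`, here with the
denominator cleared. -/
theorem growth_sub_X_mul (q : K) (f : K[X]) :
    (C q * X - 1) * (growth q f - X * f) = X * (f.comp (C q * X) - C (f.eval 1)) := by
  induction f using Polynomial.induction_on' with
  | add f g hf hg =>
    rw [map_add, add_comp, eval_add, C_add]
    linear_combination hf + hg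
  | monomial n a =>
    rw [← C_mul_X_pow_eq_monomial, growth_C_mul, growth_X_pow]
    have hg := mul_geom_sum (C q * X : K[X]) n
    have : (∑ r ∈ Finset.range n, C (q ^ r) * X ^ (r + 1) : K[X]) =
        X * ∑ r ∈ Finset.range n, (C q * X) ^ r := by
      rw [Finset.mul_sum]
      refine Finset.sum_congr rfl fun r _ => ?_
      rw [mul_pow, C_pow]
      ring
    rw [this]
    simp only [mul_comp, C_comp, pow_comp, X_comp, eval_mul, eval_C, eval_pow, eval_X, one_pow,
      mul_one]
    linear_combination X * C a * hg

theorem C_mul_X_sub_one_ne_zero (q : K) : (C q * X - 1 : K[X]) ≠ 0 := by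
  intro h
  have := congrArg (eval 0) h
  simp at this

/-- The closed form gives `X * qFall (h + 1) + q ^ h * X * qFall h`. Writing `X` as `(X - q ^ (h +
1)) + q ^ (h + 1)` and `(X - q ^ h) + q ^ h` respectively gives the three terms. -/
theorem growth_qFall_succ (q : K) (h : ℕ) :
    growth q (qFall q (h + 1)) = qFall q (h + 2) + (q ^ (h + 1) + q ^ h) • qFall q (h + 1) +
      q ^ (2 * h) • qFall q h := by
  apply mul_left_cancel₀ (C_mul_X_sub_one_ne_zero q)
  have := growth_sub_X_mul q (qFall q (h + 1))
  rw [qFall_comp, eval_one_qFall_succ] at this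
  rw [smul_eq_C_mul, smul_eq_C_mul, qFall_succ q (h + 1)]
  rw [qFall_succ q h] at this ⊢
  simp only [pow_mul', pow_succ, C_mul, C_add, C_0, pow_zero, one_mul] at this ⊢
  linear_combination this

theorem growth_one (q : K) : growth q 1 = qFall q 1 + 1 := by
  have := growth_X_pow q 0
  simp only [pow_zero, Finset.range_zero, Finset.sum_empty] at this
  rw [this]
  simp [qFall]

end PermCrossing

/-! ### Splitting 132-avoiding permutations at the maximum -/

namespace PermCrossing

/-- The number of crossings of `σ` when its values are shifted by `d`. -/
def crsShift {n : ℕ} (d : ℤ) (σ : Equiv.Perm (Fin n)) : ℕ :=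
  ∑ i : Fin n, ∑ j : Fin n,
    if i < j ∧ σ i < σ j ∧ ((j : ℤ) < σ i + d ∨ (σ j : ℤ) + d ≤ i) then 1 else 0

theorem crsShift_zero {n : ℕ} (σ : Equiv.Perm (Fin n)) : crsShift 0 σ = crs σ := by
  rw [crsShift, crs, Finset.card_filter, Fintype.sum_prod_type]
  refine Finset.sum_congr rfl fun i _ => Finset.sum_congr rfl fun j _ => ?_
  congr 1
  simp only [Fin.lt_def, Fin.le_def, eq_iff_iff]
  omega

/-- The number of crossings between the largest entry at position `k` and the entries to its
left, in a permutation of `k + m + 1` letters avoiding `132` whose values are shifted by `d`. -/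
def crsMax (k m : ℕ) (d : ℤ) : ℕ :=
  ((Finset.range k).filter fun v : ℕ => (k : ℤ) + 1 - m - d ≤ v).card +
    ((Finset.range k).filter fun v : ℕ => (k : ℤ) + m + d ≤ v).card

theorem card_filter_range_le (k : ℕ) (z : ℤ) :
    (((Finset.range k).filter fun v : ℕ => z ≤ v).card : ℤ) = max 0 (k - max 0 z) := by
  induction k with
  | zero => simp
  | succ k ih =>
    rw [Finset.range_add_one, Finset.filter_insert]
    split_ifs with h
    · rw [Finset.card_insert_of_notMem (by simp)]
      push_cast
      omega
    · push_cast
      omega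

theorem card_filter_fin_le {k : ℕ} (z : ℤ) (σ : Equiv.Perm (Fin k)) :
    (Finset.univ.filter fun i : Fin k => z ≤ (σ i : ℕ)).card =
      ((Finset.range k).filter fun v : ℕ => z ≤ v).card := by
  refine Finset.card_bij (fun i _ => (σ i : ℕ)) ?_ ?_ ?_
  · intro i hi
    simpa using hi
  · intro i _ j _ h
    exact σ.injective (Fin.ext h)
  · intro v hv
    simp only [Finset.mem_filter, Finset.mem_range] at hv
    exact ⟨σ.symm ⟨v, hv.1⟩, by simpa using hv.2, by simp⟩

/-- The word of the permutation `glue L R`: the word of `L` with its values raised by `m`,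
followed by the largest letter, followed by the word of `R`. -/
def glueFun {k m : ℕ} (L : Equiv.Perm (Fin k)) (R : Equiv.Perm (Fin m)) :
    Fin (k + (m + 1)) → Fin (k + (m + 1)) :=
  Fin.addCases (fun i => ⟨L i + m, by omega⟩)
    (Fin.cases ⟨k + m, by omega⟩ fun j => ⟨R j, by omega⟩)

section glueFun

variable {k m : ℕ} (L : Equiv.Perm (Fin k)) (R : Equiv.Perm (Fin m))

theorem glueFun_left (i : Fin k) : (glueFun L R (Fin.castAdd (m + 1) i) : ℕ) = L i + m := by
  simp [glueFun]

theorem glueFun_mid : (glueFun L R (Fin.natAdd k 0) : ℕ) = k + m := by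
  simp [glueFun]

theorem glueFun_right (j : Fin m) : (glueFun L R (Fin.natAdd k j.succ) : ℕ) = R j := by
  simp [glueFun]

theorem left_or_mid_or_right (x : Fin (k + (m + 1))) :
    (∃ i : Fin k, x = Fin.castAdd (m + 1) i) ∨ x = Fin.natAdd k 0 ∨
      ∃ j : Fin m, x = Fin.natAdd k j.succ := by
  refine Fin.addCases (fun i => Or.inl ⟨i, rfl⟩) (fun j => Or.inr ?_) x
  exact Fin.cases (Or.inl rfl) (fun j => Or.inr ⟨j, rfl⟩) j

theorem glueFun_injective : Function.Injective (glueFun L R) := by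
  intro x y h
  rw [Fin.ext_iff] at h
  rcases left_or_mid_or_right x with ⟨i, rfl⟩ | rfl | ⟨i, rfl⟩ <;>
    rcases left_or_mid_or_right y with ⟨j, rfl⟩ | rfl | ⟨j, rfl⟩ <;>
    simp only [glueFun_left, glueFun_mid, glueFun_right] at h
  · have : L i = L j := Fin.ext (by omega)
    rw [L.injective this]
  · omega
  · omega
  · omega
  · rfl
  · omega
  · omega
  · omega
  · rw [R.injective (Fin.ext h)]

/-- The permutation whose word is that of `L` with its values raised by `m`,
followed by the largest letter, followed by the word of `R`. -/
noncomputable def glue : Equiv.Perm (Fin (k + (m + 1))) :=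
  Equiv.ofBijective (glueFun L R) (glueFun_injective L R).bijective_of_finite

theorem glue_left (i : Fin k) : (glue L R (Fin.castAdd (m + 1) i) : ℕ) = L i + m :=
  glueFun_left L R i

theorem glue_mid : (glue L R (Fin.natAdd k 0) : ℕ) = k + m :=
  glueFun_mid L R

theorem glue_right (j : Fin m) : (glue L R (Fin.natAdd k j.succ) : ℕ) = R j :=
  glueFun_right L R j

theorem contains_glue_iff :
    Contains (glue L R) pattern132 ↔ Contains L pattern132 ∨ Contains R pattern132 := by
  simp only [contains_pattern132_iff]
  constructor
  · rintro ⟨a, b, c, hab, hbc, h1, h2⟩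
    rw [Fin.lt_def] at hab hbc h1 h2
    rcases left_or_mid_or_right a with ⟨a, rfl⟩ | rfl | ⟨a, rfl⟩ <;>
      rcases left_or_mid_or_right b with ⟨b, rfl⟩ | rfl | ⟨b, rfl⟩ <;>
      rcases left_or_mid_or_right c with ⟨c, rfl⟩ | rfl | ⟨c, rfl⟩ <;>
      simp only [glue_left, glue_mid, glue_right, Fin.val_castAdd, Fin.val_natAdd, Fin.val_succ,
        Fin.val_zero] at hab hbc h1 h2 <;>
      first
        | omega
        | exact Or.inl ⟨a, b, c, hab, hbc, by rw [Fin.lt_def]; omega, by rw [Fin.lt_def]; omega⟩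
        | exact Or.inr ⟨a, b, c, by rw [Fin.lt_def]; omega, by rw [Fin.lt_def]; omega, h1, h2⟩
  · rintro (⟨a, b, c, hab, hbc, h1, h2⟩ | ⟨a, b, c, hab, hbc, h1, h2⟩)
    · refine ⟨Fin.castAdd _ a, Fin.castAdd _ b, Fin.castAdd _ c, ?_⟩
      simp only [Fin.lt_def, glue_left, Fin.val_castAdd] at *
      omega
    · refine ⟨Fin.natAdd _ a.succ, Fin.natAdd _ b.succ, Fin.natAdd _ c.succ, ?_⟩
      simp only [Fin.lt_def, glue_right, Fin.val_natAdd, Fin.val_succ] at *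
      omega

/-- Pairs from the left block or the maximum to the right block descend, so never cross. Within a
block only the offset between values and positions changes: values rise by `m` on the left,
positions by `k + 1` on the right. -/
theorem crsShift_glue (d : ℤ) :
    crsShift d (glue L R) =
      crsMax k m d + crsShift (d + m) L + crsShift (d - k - 1) R := by
  have hLL : ∀ i j : Fin k, (if Fin.castAdd (m + 1) i < Fin.castAdd (m + 1) j ∧
      glue L R (Fin.castAdd (m + 1) i) < glue L R (Fin.castAdd (m + 1) j) ∧
      (((Fin.castAdd (m + 1) j : Fin (k + (m + 1))) : ℤ) <
        glue L R (Fin.castAdd (m + 1) i) + d ∨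
        (glue L R (Fin.castAdd (m + 1) j) : ℤ) + d ≤
          (Fin.castAdd (m + 1) i : Fin (k + (m + 1)))) then 1 else 0) =
      if i < j ∧ L i < L j ∧ ((j : ℤ) < L i + (d + m) ∨ (L j : ℤ) + (d + m) ≤ i)
        then 1 else 0 := by
    intro i j
    congr 1
    simp only [Fin.lt_def, glue_left, Fin.val_castAdd, eq_iff_iff]
    push_cast
    omega
  have hRR : ∀ i j : Fin m, (if Fin.natAdd k i.succ < Fin.natAdd k j.succ ∧
      glue L R (Fin.natAdd k i.succ) < glue L R (Fin.natAdd k j.succ) ∧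
      (((Fin.natAdd k j.succ : Fin (k + (m + 1))) : ℤ) < glue L R (Fin.natAdd k i.succ) + d ∨
        (glue L R (Fin.natAdd k j.succ) : ℤ) + d ≤
          (Fin.natAdd k i.succ : Fin (k + (m + 1)))) then 1 else 0) =
      if i < j ∧ R i < R j ∧
        ((j : ℤ) < R i + (d - k - 1) ∨ (R j : ℤ) + (d - k - 1) ≤ i) then 1 else 0 := by
    intro i j
    congr 1
    simp only [Fin.lt_def, glue_right, Fin.val_natAdd, Fin.val_succ, eq_iff_iff]
    push_cast
    omega
  have hLM : (∑ i : Fin k, if Fin.castAdd (m + 1) i < Fin.natAdd k 0 ∧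
      glue L R (Fin.castAdd (m + 1) i) < glue L R (Fin.natAdd k 0) ∧
      (((Fin.natAdd k 0 : Fin (k + (m + 1))) : ℤ) < glue L R (Fin.castAdd (m + 1) i) + d ∨
        (glue L R (Fin.natAdd k 0) : ℤ) + d ≤
          (Fin.castAdd (m + 1) i : Fin (k + (m + 1)))) then 1 else 0) = crsMax k m d := by
    -- One alternative bounds the value `L i`, the other the position `i`, so neither count depends
    -- on `L`. They exclude each other: the first needs `m + d ≥ 2`, the second `m + d ≤ -1`.
    have hid : (Finset.univ.filter fun i : Fin k => (k : ℤ) + m + d ≤ (i : ℕ)).card =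
        ((Finset.range k).filter fun v : ℕ => (k : ℤ) + m + d ≤ v).card :=
      card_filter_fin_le _ (Equiv.refl _)
    rw [crsMax, ← card_filter_fin_le _ L, ← hid, Finset.card_filter,
      Finset.card_filter, ← Finset.sum_add_distrib]
    refine Finset.sum_congr rfl fun i _ => ?_
    have h1 := i.isLt
    have h2 := (L i).isLt
    simp only [Fin.lt_def, glue_left, glue_mid, Fin.val_natAdd, Fin.val_castAdd, Fin.val_zero]
    push_cast
    split_ifs <;> omega
  have h0 : ∀ x y : Fin (k + (m + 1)), (¬ (x < y ∧ glue L R x < glue L R y)) →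
      (if x < y ∧ glue L R x < glue L R y ∧
        ((y : ℤ) < glue L R x + d ∨ (glue L R y : ℤ) + d ≤ x) then 1 else 0) = 0 :=
    fun x y h => if_neg fun h' => h ⟨h'.1, h'.2.1⟩
  unfold crsShift
  simp only [Fin.sum_univ_add, Fin.sum_univ_succ, Finset.sum_add_distrib, hLL, hRR, hLM]
  rw [Finset.sum_eq_zero fun i _ => Finset.sum_eq_zero fun j _ => h0 (Fin.castAdd (m + 1) i)
      (Fin.natAdd k (Fin.succ j)) ?_,
    Finset.sum_eq_zero fun i _ => h0 (Fin.natAdd k 0) (Fin.castAdd (m + 1) i) ?_,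
    h0 (Fin.natAdd k 0) (Fin.natAdd k 0) ?_,
    Finset.sum_eq_zero fun j _ => h0 (Fin.natAdd k 0) (Fin.natAdd k (Fin.succ j)) ?_,
    Finset.sum_eq_zero fun j _ => Finset.sum_eq_zero fun i _ => h0 (Fin.natAdd k (Fin.succ j))
      (Fin.castAdd (m + 1) i) ?_,
    Finset.sum_eq_zero fun j _ => h0 (Fin.natAdd k (Fin.succ j)) (Fin.natAdd k 0) ?_]
  · ring
  all_goals
    simp only [Fin.lt_def, glue_left, glue_mid, glue_right, Fin.val_natAdd, Fin.val_castAdd,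
      Fin.val_zero, Fin.val_succ]
    omega

theorem glue_inj {L L' : Equiv.Perm (Fin k)} {R R' : Equiv.Perm (Fin m)}
    (h : glue L R = glue L' R') : L = L' ∧ R = R' := by
  constructor
  · ext i
    have := glue_left L R i
    rw [h, glue_left] at this
    omega
  · ext i
    have := glue_right L R i
    rw [h, glue_right] at this
    omega

/-- Avoiding 132 forces every entry left of the maximum above every entry right of it; counting then
fixes the range of values of each block. -/
theorem exists_glue {σ : Equiv.Perm (Fin (k + (m + 1)))} (hσ : ¬ Contains σ pattern132)
    (hk : (σ (Fin.natAdd k 0) : ℕ) = k + m) : ∃ L R, σ = glue L R := by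
  rw [contains_pattern132_iff] at hσ
  push Not at hσ
  have hdec : ∀ (i : Fin k) (j : Fin m),
      σ (Fin.natAdd k j.succ) < σ (Fin.castAdd (m + 1) i) := by
    intro i j
    by_contra! hc
    have hij : Fin.castAdd (m + 1) i < Fin.natAdd k j.succ := by
      rw [Fin.lt_def, Fin.val_castAdd, Fin.val_natAdd]
      omega
    have h1 := hσ (Fin.castAdd (m + 1) i) (Fin.natAdd k 0) (Fin.natAdd k j.succ)
      (by simp [Fin.lt_def]) (by simp [Fin.lt_def]) (lt_of_le_of_ne hc (σ.injective.ne hij.ne))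
    have h2 : σ (Fin.natAdd k 0) ≠ σ (Fin.natAdd k j.succ) :=
      σ.injective.ne (by simp [Fin.ext_iff])
    rw [Fin.le_def, hk] at h1
    rw [Ne, Fin.ext_iff, hk] at h2
    omega
  have hL : ∀ i : Fin k, m ≤ σ (Fin.castAdd (m + 1) i) ∧
      (σ (Fin.castAdd (m + 1) i) : ℕ) < k + m := by
    intro i
    constructor
    · have hsub : (Finset.univ.image fun j : Fin m => σ (Fin.natAdd k j.succ)) ⊆
          Finset.Iio (σ (Fin.castAdd (m + 1) i)) := by
        intro x hx
        simp only [Finset.mem_image, Finset.mem_univ, true_and] at hx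
        obtain ⟨j, rfl⟩ := hx
        exact Finset.mem_Iio.2 (hdec i j)
      have := Finset.card_le_card hsub
      rwa [Finset.card_image_of_injective, Finset.card_univ, Fintype.card_fin,
        Fin.card_Iio] at this
      intro j j' h
      simpa using h
    · have h2 : σ (Fin.natAdd k 0) ≠ σ (Fin.castAdd (m + 1) i) :=
        σ.injective.ne (by simp only [Ne, Fin.ext_iff, Fin.val_natAdd, Fin.val_castAdd]; omega)
      rw [Ne, Fin.ext_iff, hk] at h2
      omega
  have hR : ∀ j : Fin m, (σ (Fin.natAdd k j.succ) : ℕ) < m := by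
    intro j
    have hsub : (Finset.univ.image fun i : Fin k => σ (Fin.castAdd (m + 1) i)) ⊆
        Finset.Ioo (σ (Fin.natAdd k j.succ)) (σ (Fin.natAdd k 0)) := by
      intro x hx
      simp only [Finset.mem_image, Finset.mem_univ, true_and] at hx
      obtain ⟨i, rfl⟩ := hx
      refine Finset.mem_Ioo.2 ⟨hdec i j, ?_⟩
      rw [Fin.lt_def, hk]
      exact (hL i).2
    have := Finset.card_le_card hsub
    rw [Finset.card_image_of_injective, Finset.card_univ, Fintype.card_fin,
      Fin.card_Ioo, hk] at this
    · have h2 : σ (Fin.natAdd k 0) ≠ σ (Fin.natAdd k j.succ) :=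
        σ.injective.ne (by simp [Fin.ext_iff])
      rw [Ne, Fin.ext_iff, hk] at h2
      omega
    · intro i i' h
      simpa using h
  let L : Fin k → Fin k := fun i => ⟨σ (Fin.castAdd (m + 1) i) - m, by have := hL i; omega⟩
  let R : Fin m → Fin m := fun j => ⟨σ (Fin.natAdd k j.succ), hR j⟩
  have hLi : Function.Injective L := by
    intro i i' h
    simp only [L, Fin.mk.injEq] at h
    have h1 := hL i
    have h2 := hL i'
    have : σ (Fin.castAdd (m + 1) i) = σ (Fin.castAdd (m + 1) i') := Fin.ext (by omega)
    simpa using this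
  have hRi : Function.Injective R := by
    intro j j' h
    simp only [R, Fin.mk.injEq] at h
    simpa using Fin.ext h
  refine ⟨Equiv.ofBijective L hLi.bijective_of_finite,
    Equiv.ofBijective R hRi.bijective_of_finite, ?_⟩
  ext x
  rcases left_or_mid_or_right x with ⟨i, rfl⟩ | rfl | ⟨i, rfl⟩
  · rw [glue_left]
    have h1 := hL i
    simp only [Equiv.ofBijective_apply, L]
    omega
  · rw [glue_mid, hk]
  · rw [glue_right]
    simp [R]

end glueFun

variable {K : Type*} [Field K]

/-- The distribution of the crossings over the permutations of `n` letters avoiding `132` with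
values shifted by `d`. -/
noncomputable def shiftSum (q : K) (n : ℕ) (d : ℤ) : K :=
  ∑ σ ∈ avoiders n pattern132, q ^ crsShift d σ

theorem shiftSum_zero (q : K) (d : ℤ) : shiftSum q 0 d = 1 := by
  have hav : avoiders 0 pattern132 = Finset.univ := by
    ext σ
    simp only [mem_avoiders, contains_pattern132_iff, Finset.mem_univ, iff_true]
    rintro ⟨a, -⟩
    exact a.elim0
  rw [shiftSum, hav]
  simp [crsShift]

theorem sum_filter_apply_eq_last (q : K) (k m : ℕ) (d : ℤ) :
    ∑ σ ∈ avoiders (k + (m + 1)) pattern132 with (σ (Fin.natAdd k 0) : ℕ) = k + m,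
        q ^ crsShift d σ =
      q ^ crsMax k m d * shiftSum q k (d + m) * shiftSum q m (d - k - 1) := by
  rw [shiftSum, shiftSum, mul_assoc, Finset.sum_mul_sum, ← Finset.sum_product', Finset.mul_sum]
  symm
  refine Finset.sum_bij (fun x _ => glue x.1 x.2) ?_ ?_ ?_ ?_
  · rintro ⟨L, R⟩ h
    simp only [Finset.mem_product, mem_avoiders] at h
    simp [mem_avoiders, contains_glue_iff, glue_mid, h]
  · rintro ⟨L, R⟩ - ⟨L', R'⟩ - h
    obtain ⟨rfl, rfl⟩ := glue_inj h
    rfl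
  · intro σ h
    rw [Finset.mem_filter, mem_avoiders] at h
    obtain ⟨L, R, rfl⟩ := exists_glue h.1 h.2
    rw [contains_glue_iff, not_or] at h
    exact ⟨(L, R), by simp [mem_avoiders, h], rfl⟩
  · rintro ⟨L, R⟩ -
    rw [crsShift_glue, pow_add, pow_add, mul_assoc]

theorem shiftSum_succ (q : K) (n : ℕ) (d : ℤ) :
    shiftSum q (n + 1) d = ∑ k ∈ Finset.range (n + 1), q ^ crsMax k (n - k) d *
      shiftSum q k (d + (n - k : ℕ)) * shiftSum q (n - k) (d - k - 1) := by
  rw [← Fin.sum_univ_eq_sum_range (fun k => q ^ crsMax k (n - k) d *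
      shiftSum q k (d + (n - k : ℕ)) * shiftSum q (n - k) (d - k - 1)), shiftSum,
    ← Finset.sum_fiberwise _ (fun σ => σ.symm (Fin.last n))]
  refine Finset.sum_congr rfl ?_
  rintro ⟨k, hk⟩ -
  obtain ⟨m, rfl⟩ := Nat.exists_eq_add_of_le (Nat.lt_succ_iff.1 hk)
  simp only [Nat.add_sub_cancel_left]
  rw [← sum_filter_apply_eq_last]
  refine Finset.sum_congr ?_ fun _ _ => rfl
  ext σ
  rw [Finset.mem_filter, Finset.mem_filter, Equiv.symm_apply_eq, Fin.ext_iff, eq_comm (a := _)]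
  rfl

end PermCrossing

/-! ### Weighted Dyck paths in the incidence algebra of the integers -/

namespace PermCrossing

open IncidenceAlgebra

variable {K : Type*} [Field K]

section StrictlyUpper

variable {R : Type*} [Ring R]

theorem eq_zero_of_eq_mul_self {B E : IncidenceAlgebra R ℤ} (hB : ∀ x, B x x = 0)
    (hE : E = B * E) : E = 0 := by
  have key : ∀ n : ℕ, ∀ x y : ℤ, (y - x).toNat ≤ n → E x y = 0 := by
    intro n
    induction n with
    | zero =>
      intro x y hn
      rcases lt_trichotomy x y with h | rfl | h
      · omega
      · rw [hE]
        simp [hB]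
      · exact apply_eq_zero_of_not_le (not_le.2 h) E
    | succ n ih =>
      intro x y hn
      rw [hE, mul_apply]
      refine Finset.sum_eq_zero fun z hz => ?_
      rw [Finset.mem_Icc] at hz
      rcases hz.1.eq_or_lt with rfl | h
      · rw [hB, zero_mul]
      · rw [ih z y (by omega), mul_zero]
  ext x y _
  exact key _ x y le_rfl

/-- A right inverse of `1 - B` with `B` strictly upper triangular is also a left inverse. This turns
first-return into last-return decompositions. -/
theorem eq_one_add_mul_of_eq_one_add_mul {A B : IncidenceAlgebra R ℤ} (hB : ∀ x, B x x = 0)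
    (h : A = 1 + B * A) : A = 1 + A * B := by
  have hBA : B * A = A - 1 := eq_sub_of_add_eq' h.symm
  have : A - 1 - A * B = 0 := by
    apply eq_zero_of_eq_mul_self hB
    rw [mul_sub, mul_sub, ← mul_assoc, hBA, mul_one, sub_mul, one_mul]
    abel
  rw [sub_sub, sub_eq_zero] at this
  exact this

end StrictlyUpper

/-- The generating function of the permutations avoiding `132`, seen as Dyck paths between two
points of the line, with respect to crossings. It vanishes if the points have odd distance. -/
noncomputable def dyckSum (s : K) : IncidenceAlgebra K ℤ where
  toFun x y := if x ≤ y ∧ Even (y - x) then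
    shiftSum (s ^ 2) ((y - x) / 2).toNat (-(x + (y - x) / 2)) else 0
  eq_zero_of_not_le' _ _ h := if_neg fun h' => h h'.1

theorem dyckSum_add (s : K) (x : ℤ) (n : ℕ) :
    dyckSum s x (x + 2 * n) = shiftSum (s ^ 2) n (-(x + n)) := by
  change ite _ _ _ = _
  rw [if_pos ⟨by omega, by simp⟩]
  have : (x + 2 * (n : ℤ) - x) / 2 = n := by omega
  rw [this, Int.toNat_natCast]

theorem dyckSum_of_not_even (s : K) {x y : ℤ} (h : ¬ Even (y - x)) : dyckSum s x y = 0 :=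
  if_neg fun h' => h h'.2

/-- The weight of an arc of a Dyck path between the steps `a` and `b`. -/
noncomputable def arcWeight (s : K) (a b : ℤ) : K :=
  s ^ (|(|a| - |b|)| - 1)

/-- The generating function of the Dyck paths whose first and last steps are matched. -/
noncomputable def primeSum (s : K) : IncidenceAlgebra K ℤ where
  toFun x y := if x < y then arcWeight s (x + 1) y * dyckSum s (x + 1) (y - 1) else 0
  eq_zero_of_not_le' _ _ h := if_neg fun h' => h h'.le

theorem primeSum_apply_of_lt (s : K) {x y : ℤ} (h : x < y) :
    primeSum s x y = arcWeight s (x + 1) y * dyckSum s (x + 1) (y - 1) :=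
  if_pos h

theorem primeSum_self (s : K) (x : ℤ) : primeSum s x x = 0 :=
  if_neg (lt_irrefl x)

/-- With the shift equal to minus the midpoint, `m` cancels from both counts. The two ends have
opposite parity, so the exponent of `s` is even and nonnegative. -/
theorem arcWeight_eq_pow_crsMax (s : K) (x : ℤ) (k m : ℕ) :
    arcWeight s (x + 1) (x + 2 * k + 2) = (s ^ 2) ^ crsMax k m (-(x + (k + m + 1 : ℕ))) := by
  rw [arcWeight, ← pow_mul, ← zpow_natCast]
  congr 1
  unfold crsMax
  push_cast
  rw [card_filter_range_le, card_filter_range_le]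
  simp only [abs_eq_max_neg]
  omega

/-- A maximum at position `k` corresponds to a first return after `2 * k + 2` steps. -/
theorem dyckSum_eq_one_add_prime_mul (s : K) : dyckSum s = 1 + primeSum s * dyckSum s := by
  ext x y hxy
  rw [IncidenceAlgebra.add_apply, mul_apply, one_apply]
  by_cases hpar : Even (y - x)
  · obtain ⟨n, rfl⟩ : ∃ n : ℕ, y = x + 2 * n := by
      obtain ⟨t, ht⟩ := hpar
      exact ⟨t.toNat, by omega⟩
    rw [dyckSum_add]
    rcases n with _ | n
    · simp [primeSum_self, shiftSum_zero]
    · rw [if_neg (by push_cast; omega), zero_add, shiftSum_succ]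
      refine Finset.sum_of_injOn (fun k : ℕ => x + 2 * k + 2) ?_ ?_ ?_ ?_
      · intro a _ b _ h
        simp only at h
        omega
      · intro k hk
        simp only [Finset.coe_range, Set.mem_Iio, Finset.coe_Icc, Set.mem_Icc] at hk ⊢
        push_cast
        omega
      · intro z hz hz'
        rw [Finset.mem_Icc] at hz
        push_cast at hz
        rcases hz.1.eq_or_lt with rfl | hlt
        · rw [primeSum_self, zero_mul]
        rw [primeSum_apply_of_lt s hlt, dyckSum_of_not_even, mul_zero, zero_mul]
        rintro ⟨t, ht⟩
        refine hz' ⟨t.toNat, ?_, ?_⟩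
        · simp only [Finset.coe_range, Set.mem_Iio]
          omega
        · simp only
          omega
      · intro k hk
        rw [Finset.mem_range] at hk
        obtain ⟨m, rfl⟩ := Nat.exists_eq_add_of_le (Nat.lt_succ_iff.1 hk)
        rw [Nat.add_sub_cancel_left, primeSum_apply_of_lt s (by omega),
          arcWeight_eq_pow_crsMax s x k m,
          show x + 2 * (k : ℤ) + 2 - 1 = (x + 1) + 2 * k by ring, dyckSum_add,
          show x + 2 * ((k + m + 1 : ℕ) : ℤ) = (x + 2 * k + 2) + 2 * m by push_cast; ring,
          dyckSum_add]
        congr 2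
        · congr 1
          push_cast
          ring
        · push_cast
          ring
  · rw [dyckSum_of_not_even s hpar, if_neg (by rintro rfl; simp at hpar), zero_add]
    symm
    refine Finset.sum_eq_zero fun z hz => ?_
    rw [Finset.mem_Icc] at hz
    by_cases h1 : Even (y - z)
    · rcases hz.1.eq_or_lt with rfl | hlt
      · rw [primeSum_self, zero_mul]
      rw [primeSum_apply_of_lt s hlt, dyckSum_of_not_even, mul_zero, zero_mul]
      intro h2
      apply hpar
      have := (h1.add h2).add (even_two (α := ℤ))
      ring_nf at this ⊢
      exact this
    · rw [dyckSum_of_not_even s h1, mul_zero]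

theorem dyckSum_eq_one_add_mul_prime (s : K) : dyckSum s = 1 + dyckSum s * primeSum s :=
  eq_one_add_mul_of_eq_one_add_mul (primeSum_self s) (dyckSum_eq_one_add_prime_mul s)

/-! ### Cutting arcs at the ends of an interval -/

/-- The weight of a step that is matched to a step outside of an interval. -/
noncomputable def stepSum (s : K) : IncidenceAlgebra K ℤ where
  toFun x y := if y = x + 1 then s ^ (-1 - |y|) else 0
  eq_zero_of_not_le' _ _ h := if_neg fun h' => h (by omega)

theorem stepSum_apply (s : K) (x y : ℤ) :
    stepSum s x y = if y = x + 1 then s ^ (-1 - |y|) else 0 := rfl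

theorem mul_stepSum_apply (s : K) (f : IncidenceAlgebra K ℤ) (x y : ℤ) :
    (f * stepSum s) x y = f x (y - 1) * s ^ (-1 - |y|) := by
  rw [mul_apply]
  by_cases h : x ≤ y - 1
  · rw [Finset.sum_eq_single (y - 1)]
    · rw [stepSum_apply, if_pos (by ring)]
    · intro z _ hz
      rw [stepSum_apply, if_neg (by omega), mul_zero]
    · intro hn
      exact absurd (Finset.mem_Icc.2 ⟨h, by omega⟩) hn
  · rw [apply_eq_zero_of_not_le h, zero_mul]
    refine Finset.sum_eq_zero fun z hz => ?_
    rw [Finset.mem_Icc] at hz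
    rw [stepSum_apply, if_neg (by omega), mul_zero]

theorem stepSum_mul_apply (s : K) (f : IncidenceAlgebra K ℤ) (x y : ℤ) :
    (stepSum s * f) x y = s ^ (-1 - |x + 1|) * f (x + 1) y := by
  rw [mul_apply]
  by_cases h : x + 1 ≤ y
  · rw [Finset.sum_eq_single (x + 1)]
    · rw [stepSum_apply, if_pos rfl]
    · intro z _ hz
      rw [stepSum_apply, if_neg (by omega), zero_mul]
    · intro hn
      exact absurd (Finset.mem_Icc.2 ⟨by omega, h⟩) hn
  · rw [apply_eq_zero_of_not_le h, mul_zero]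
    refine Finset.sum_eq_zero fun z hz => ?_
    rw [Finset.mem_Icc] at hz
    rw [stepSum_apply, if_neg (by omega), zero_mul]

theorem arcWeight_of_le_left (s : K) (hs : s ≠ 0) {a b : ℤ} (h : |a| ≤ |b|) :
    arcWeight s a b = s ^ |b| * s ^ (-1 - |a|) := by
  rw [arcWeight, ← zpow_add₀ hs, abs_of_nonpos (by linarith)]
  congr 1
  ring

theorem arcWeight_of_le_right (s : K) (hs : s ≠ 0) {a b : ℤ} (h : |b| ≤ |a|) :
    arcWeight s a b = s ^ |a| * s ^ (-1 - |b|) := by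
  rw [arcWeight, ← zpow_add₀ hs, abs_of_nonneg (by linarith)]
  congr 1
  ring

/-- When `|y|` dominates, the last arc's weight factors: its closing step gives `s ^ |y|` and its
opening step becomes open. -/
theorem mul_primeSum_apply (s : K) (hs : s ≠ 0) (f : IncidenceAlgebra K ℤ) {x y : ℤ}
    (h : ∀ z, x < z → z < y → |z| ≤ |y|) :
    (f * primeSum s) x y = s ^ |y| * (f * (stepSum s * dyckSum s)) x (y - 1) := by
  rw [mul_apply, mul_apply, Finset.mul_sum]
  symm
  rw [Finset.sum_subset (Finset.Icc_subset_Icc_right (show y - 1 ≤ y by omega))]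
  · refine Finset.sum_congr rfl fun z hz => ?_
    rw [Finset.mem_Icc] at hz
    rw [stepSum_mul_apply]
    by_cases hzy : z + 1 ≤ y - 1
    · rw [primeSum_apply_of_lt s (by omega),
        arcWeight_of_le_left s hs (h (z + 1) (by omega) (by omega))]
      ring
    · rw [apply_eq_zero_of_not_le hzy]
      rcases hz.2.eq_or_lt with rfl | hlt
      · rw [primeSum_self]
        ring
      · rw [primeSum_apply_of_lt s hlt, apply_eq_zero_of_not_le hzy]
        ring
  · intro z _ hz
    rw [apply_eq_zero_of_not_le (f := stepSum s * dyckSum s), mul_zero, mul_zero]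
    simp_all

theorem primeSum_mul_apply (s : K) (hs : s ≠ 0) (f : IncidenceAlgebra K ℤ) {x y : ℤ}
    (h : ∀ z, x + 1 < z → z ≤ y → |z| ≤ |x + 1|) :
    (primeSum s * f) x y = s ^ |x + 1| * ((dyckSum s * stepSum s) * f) (x + 1) y := by
  rw [mul_apply, mul_apply, Finset.mul_sum]
  symm
  rw [Finset.sum_subset (Finset.Icc_subset_Icc_left (show x ≤ x + 1 by omega))]
  · refine Finset.sum_congr rfl fun z hz => ?_
    rw [Finset.mem_Icc] at hz
    rw [mul_stepSum_apply]
    by_cases hzy : x + 1 ≤ z - 1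
    · rw [primeSum_apply_of_lt s (by omega),
        arcWeight_of_le_right s hs (h z (by omega) hz.2)]
      ring
    · rw [apply_eq_zero_of_not_le hzy]
      rcases hz.1.eq_or_lt with rfl | hlt
      · rw [primeSum_self]
        ring
      · rw [primeSum_apply_of_lt s hlt, apply_eq_zero_of_not_le hzy]
        ring
  · intro z _ hz
    rw [apply_eq_zero_of_not_le (f := dyckSum s * stepSum s), zero_mul, mul_zero]
    simp_all

/-- The generating function of the paths on an interval with `h` steps matched to steps
outside of the interval. -/
noncomputable def openSum (s : K) (h : ℕ) : IncidenceAlgebra K ℤ :=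
  (dyckSum s * stepSum s) ^ h * dyckSum s

theorem openSum_zero (s : K) : openSum s 0 = dyckSum s := by
  rw [openSum, pow_zero, one_mul]

theorem openSum_succ (s : K) (h : ℕ) :
    openSum s (h + 1) = (dyckSum s * stepSum s) * openSum s h := by
  rw [openSum, openSum, pow_succ', mul_assoc]

theorem openSum_succ' (s : K) (h : ℕ) :
    openSum s (h + 1) = openSum s h * (stepSum s * dyckSum s) := by
  rw [openSum, openSum, pow_succ]
  simp only [mul_assoc]

theorem openSum_zero_right (s : K) (hs : s ≠ 0) {x y : ℤ} (hxy : x ≠ y)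
    (hz : ∀ z, x < z → z < y → |z| ≤ |y|) :
    openSum s 0 x y = s ^ |y| * openSum s 1 x (y - 1) := by
  rw [openSum_succ', openSum_zero, ← mul_primeSum_apply s hs _ hz]
  conv_lhs => rw [dyckSum_eq_one_add_mul_prime]
  rw [IncidenceAlgebra.add_apply, one_apply, if_neg hxy, zero_add]

/-- The last step is either open or closes an arc, and cutting that arc creates one more open step.
-/
theorem openSum_succ_right (s : K) (hs : s ≠ 0) (h : ℕ) {x y : ℤ}
    (hz : ∀ z, x < z → z < y → |z| ≤ |y|) :
    openSum s (h + 1) x y =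
      openSum s h x (y - 1) * s ^ (-1 - |y|) + s ^ |y| * openSum s (h + 2) x (y - 1) := by
  rw [openSum_succ' s (h + 1), ← mul_primeSum_apply s hs _ hz, ← mul_stepSum_apply,
    ← IncidenceAlgebra.add_apply]
  rw [openSum_succ']
  conv_lhs => rw [dyckSum_eq_one_add_mul_prime]
  simp only [mul_add, mul_one, mul_assoc]

theorem openSum_succ_left (s : K) (hs : s ≠ 0) (h : ℕ) {x y : ℤ}
    (hz : ∀ z, x + 1 < z → z ≤ y → |z| ≤ |x + 1|) :
    openSum s (h + 1) x y = s ^ (-1 - |x + 1|) * openSum s h (x + 1) y +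
      s ^ |x + 1| * openSum s (h + 2) (x + 1) y := by
  rw [openSum_succ s (h + 1), ← primeSum_mul_apply s hs _ hz, ← stepSum_mul_apply,
    ← IncidenceAlgebra.add_apply]
  rw [openSum_succ]
  conv_lhs => rw [dyckSum_eq_one_add_prime_mul]
  simp only [add_mul, one_mul, mul_assoc]

/-- A step is labelled by its right end, so the first step here is `-r`. Once the last step `r + 1`
of the symmetric interval is gone, it is the one that dominates. -/
theorem openSum_succ_left_symm (s : K) (hs : s ≠ 0) (h r : ℕ) :
    s ^ (r + 1) * openSum s (h + 1) (-((r + 1 : ℕ) : ℤ)) r =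
      openSum s h (-r) r + s ^ (2 * r + 1) * openSum s (h + 2) (-r) r := by
  have e : -((r + 1 : ℕ) : ℤ) + 1 = -r := by push_cast; ring
  rw [openSum_succ_left s hs h, e, abs_neg, Nat.abs_cast]
  · have : s ^ (r + 1) * s ^ (-1 - (r : ℤ)) = 1 := by
      rw [← zpow_natCast, ← zpow_add₀ hs]
      push_cast
      ring_nf
      simp
    rw [zpow_natCast]
    linear_combination openSum s h (-r) r * this
  · intro z h1 h2
    rw [e] at h1 ⊢
    rw [abs_neg, Nat.abs_cast, abs_le]
    omega

theorem abs_le_of_symm {r : ℕ} (z : ℤ) (h1 : -((r + 1 : ℕ) : ℤ) < z) (h2 : z < (r + 1 : ℕ)) :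
    |z| ≤ |((r + 1 : ℕ) : ℤ)| := by
  rw [Nat.abs_cast, abs_le]
  omega

theorem openSum_zero_symm (s : K) (hs : s ≠ 0) (r : ℕ) :
    openSum s 0 (-((r + 1 : ℕ) : ℤ)) (r + 1 : ℕ) =
      openSum s 0 (-r) r + s ^ (2 * r + 1) * openSum s 2 (-r) r := by
  rw [openSum_zero_right s hs (by omega) abs_le_of_symm, Nat.abs_cast, zpow_natCast,
    ← openSum_succ_left_symm s hs]
  simp

theorem openSum_succ_symm (s : K) (hs : s ≠ 0) (h r : ℕ) :
    s ^ (2 * r + 3) * openSum s (h + 2) (-((r + 1 : ℕ) : ℤ)) (r + 1 : ℕ) =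
      openSum s h (-r) r + (s ^ (2 * r + 1) + s ^ (2 * r + 3)) * openSum s (h + 2) (-r) r +
        s ^ (4 * r + 4) * openSum s (h + 4) (-r) r := by
  have h1 := openSum_succ_left_symm s hs h r
  have h2 := openSum_succ_left_symm s hs (h + 2) r
  have e : ((r + 1 : ℕ) : ℤ) - 1 = r := by simp
  have hp : s ^ (r + 2) * s ^ (-1 - ((r + 1 : ℕ) : ℤ)) = 1 := by
    rw [← zpow_natCast, ← zpow_add₀ hs]
    push_cast
    ring_nf
    simp
  rw [openSum_succ_right s hs (h + 1) abs_le_of_symm, Nat.abs_cast, zpow_natCast, e]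
  linear_combination h1 + s ^ (2 * r + 3) * h2 +
    s ^ (r + 1) * openSum s (h + 1) (-((r + 1 : ℕ) : ℤ)) r * hp

theorem openSum_apply_zero_zero (s : K) (h : ℕ) :
    openSum s h 0 0 = if h = 0 then 1 else 0 := by
  cases h with
  | zero =>
    have := dyckSum_add s 0 0
    simp only [Nat.cast_zero, mul_zero, add_zero, shiftSum_zero] at this
    simp [openSum_zero, this]
  | succ h => simp [openSum_succ', stepSum_apply]

/-- The power of `s` rescales the recursion for `openSum` to the coefficients of
`growth_qFall_succ`. At `r = 0` both sides are 1 for `h = 0` and 0 otherwise. -/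
theorem openSum_eq_eval_growth (s : K) (hs : s ≠ 0) (r h : ℕ) :
    s ^ (2 * h * r + h ^ 2) * openSum s (2 * h) (-r) r =
      ((growth (s ^ 2) ^ r) (qFall (s ^ 2) h)).eval 1 := by
  induction r generalizing h with
  | zero =>
    cases h with
    | zero => simp [openSum_apply_zero_zero, qFall_zero]
    | succ h => simp [openSum_apply_zero_zero, eval_one_qFall_succ]
  | succ r ih =>
    -- The innermost `growth` is peeled off, so that it acts on a basis element.
    rw [pow_succ (growth (s ^ 2)), Module.End.mul_apply]
    cases h with
    | zero =>
      have h0 := ih 0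
      have h1 := ih 1
      rw [qFall_zero] at h0 ⊢
      rw [growth_one, map_add, Polynomial.eval_add, ← h0, ← h1]
      simp only [mul_zero, zero_mul, zero_add, mul_one, one_pow, pow_zero, one_mul, ne_eq,
        OfNat.ofNat_ne_zero, not_false_eq_true, zero_pow]
      rw [openSum_zero_symm s hs]
      ring
    | succ h =>
      rw [growth_qFall_succ, map_add, map_add, map_smul, map_smul, Polynomial.eval_add,
        Polynomial.eval_add, Polynomial.eval_smul, Polynomial.eval_smul, ← ih, ← ih, ← ih,
        smul_eq_mul, smul_eq_mul]
      have := openSum_succ_symm s hs (2 * h) r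
      rw [show 2 * (h + 1) = 2 * h + 2 by ring, show 2 * (h + 2) = 2 * h + 4 by ring]
      -- This exponent is `2 * (h + 1) * (r + 1) + (h + 1) ^ 2` less the `2 * r + 3` present in
      -- `this`.
      linear_combination s ^ (2 * h * r + h ^ 2 + 4 * h) * this

theorem sum_crs_avoiders_pattern132 (s : K) (hs : s ≠ 0) (n : ℕ) :
    ∑ σ ∈ avoiders n pattern132, (s ^ 2) ^ crs σ = ((growth (s ^ 2) ^ n) 1).eval 1 := by
  have h := openSum_eq_eval_growth s hs n 0
  have h2 := dyckSum_add s (-n) n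
  rw [show -(n : ℤ) + 2 * n = n by ring, neg_add_cancel, neg_zero] at h2
  rw [qFall_zero, mul_zero, openSum_zero, h2] at h
  rw [← h, shiftSum]
  simp [crsShift_zero]

/-- Taking `s = √q` proves equality at every real `q > 0`, infinitely many points. -/
theorem crsPoly_pattern321_eq_pattern132 (n : ℕ) :
    crsPoly n pattern321 = crsPoly n pattern132 := by
  apply Polynomial.map_injective (Int.castRingHom ℝ) Int.cast_injective
  refine Polynomial.eq_of_infinite_eval_eq _ _ ((Set.Ioi_infinite (0 : ℝ)).mono fun q hq => ?_)
  have hs : √q ≠ 0 := (Real.sqrt_pos.2 hq).ne'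
  have h1 := sum_crs_avoiders_pattern321 (√q ^ 2) n
  have h2 := sum_crs_avoiders_pattern132 (√q) hs n
  rw [Real.sq_sqrt (le_of_lt hq)] at h1 h2
  simp only [Set.mem_ofPred_eq, crsPoly, Polynomial.map_sum, Polynomial.map_pow, Polynomial.map_X,
    Polynomial.eval_finsetSum, Polynomial.eval_pow, Polynomial.eval_X]
  rw [h1, h2]

end PermCrossing

theorem mainTheorem1 (n : ℕ) (hn : 1 ≤ n) :
    PermCrossing.crsPoly n PermCrossing.pattern321 =
        PermCrossing.crsPoly n PermCrossing.pattern132 ∧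
      PermCrossing.crsPoly n PermCrossing.pattern132 =
        PermCrossing.crsPoly n PermCrossing.pattern213 :=
  ⟨PermCrossing.crsPoly_pattern321_eq_pattern132 n,
    PermCrossing.crsPoly_pattern132_eq_pattern213 n⟩
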